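/- Setting. Let $\mathcal H_A,\mathcal H_K$ be complex Hilbert spaces of dimension $d$. For $J=1,\dots,n$ let $M^{(J)}=(M^{(J)}_i)_{i=1}^m$ be measurement operators on $\mathcal H_K$, i.e. $\sum_i M_i^{(J)\dagger}M_i^{(J)}=\mathbb I$ (the king's measurements). For a Hilbert space $\mathcal H_{B}$, a pair of a unit vector $\psi\in\mathcal H_{B}\otimes\mathcal H_K$ and a POVM $(E_k)_k$ on $\mathcal H_{B}\otimes\mathcal H_K$ solves the mean king's problem if there is a guessing function $s(k,J)\in\{1,\dots,m\}$ such that $s(k,J)=i$ whenever $\langle (\mathbb I\otimes M_i^{(J)})\psi\,|\,E_k(\mathbb I\otimes M_i^{(J)})\psi\rangle\neq0$, i.e. whenever the king's outcome $i$ of $M^{(J)}$ followed by Alice's outcome $k$ has nonzero probability. A $(D,D')$ quantum code is a $D'$-dimensional subspace $C$ of a $D$-dimensional Hilbert space $\mathcal H$, and its unit vectors are its code states. It is a $(D,D')$ quantum error-correcting code against an error $(E_k)_k$ (operators on $\mathcal H$ with $\sum_kE_k^\dagger E_k\le\mathbb I$) if there is a trace-preserving completely positive map $R$ on the operators on $\mathcal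 H$ such that $R\big(\sum_kE_k\rho E_k^\dagger\big)\propto\rho$ (with a factor $\geq 0$) for every density operator $\rho$ on $C$. Let $\{\psi_j\}_{j=0}^{d-1}$, $\{\phi_j\}_{j=0}^{d-1}$ be orthonormal bases of $\mathcal H_A$, $\mathcal H_K$, let $\eta_j>0$ with $\sum_j\eta_j^2=1$, put $|\Psi_\eta\rangle=\sum_j\eta_j|\psi_j\rangle\otimes|\phi_j\rangle$, and let $\mathcal P=(|p_k\rangle\langle p_k|)_{k=1}^{d^2}$ be the PVM of an orthonormal basis of $\mathcal H_A\otimes\mathcal H_K$. Theorem. Suppose $|\Psi_\eta\rangle$ and $\mathcal P$ solve the mean king's problem. (a) There are operators $(L_k)_{k=1}^{d^2}$ on $\mathcal H_K$ with $\sum_kL_k^\dagger L_k\le\mathbb I$ and index sets $X^{(J,i)}\subset\{1,\dots,d^2\}$ such that, for some $\alpha>0$ and $f^{(J,i)}_k\in\mathbb C$, $$X^{(J,i)}\cap X^{(J,i')}=\emptyset\ (i\ne i'),\qquad M^{(J)}_i=\sum_{k\in X^{(J,i)}}f^{(J,i)}_kL_k,\qquad \langle(\mathbb I\otimes L_k)\Psi_\eta|(\mathbb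 I\otimes L_{k'})\Psi_\eta\rangle=\frac{\alpha}{d}\delta_{kk'}.$$ (b) For every such family $(L_k)_k$, $(X^{(J,i)})_{J,i}$, every Hilbert space $\mathcal H_{A'}$ of finite dimension $d_A\ge d$ and every orthonormal basis $\{\xi_i\}_{i=0}^{d_A-1}$ of $\mathcal H_{A'}$, let $C\subset\mathcal H_{A'}\otimes\mathcal H_K$ be the span of $$|\Psi_{\eta,l}\rangle=\sum_{j=0}^{d-1}\eta_j|\xi_{d(l-1)+j}\rangle\otimes|\phi_j\rangle,\qquad l=1,\dots,\lfloor d_A/d\rfloor .$$ Then $C$ is a $(d_Ad,\lfloor d_A/d\rfloor)$ quantum error-correcting code against the error $(\mathbb I\otimes L_k)_k$. Moreover, the orthogonal projections onto the subspaces $(\mathbb I\otimes L_k)C$, $k=1,\dots,d^2$, together with $\mathbb I$ minus their sum, form a PVM, and every code state of $C$ paired with this PVM solves the mean king's problem. -/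

import Mathlib

open scoped TensorProduct ComplexOrder InnerProductSpace

namespace MeanKing

noncomputable section

/-! ### Measurements, quantum operations and quantum error-correcting codes -/

section General

variable {H : Type*} [NormedAddCommGroup H] [InnerProductSpace ℂ H] [FiniteDimensional ℂ H]

/-- `(M_i)` is a collection of measurement operators: `∑ i, M_i† M_i = 1`. -/
def IsMeasurement {ι : Type*} [Fintype ι] (M : ι → (H →ₗ[ℂ] H)) : Prop :=
  ∑ i, LinearMap.adjoint (M i) ∘ₗ M i = LinearMap.id

/-- A POVM with outcomes in `κ`: positive operators that sum to the identity. -/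
def IsPOVM {κ : Type*} [Fintype κ] (E : κ → (H →ₗ[ℂ] H)) : Prop :=
  (∀ k, (E k).IsPositive) ∧ ∑ k, E k = LinearMap.id

/-- A PVM with outcomes in `κ`: pairwise orthogonal projections that sum to the identity. -/
def IsPVM {κ : Type*} [Fintype κ] (E : κ → (H →ₗ[ℂ] H)) : Prop :=
  (∀ k, (E k).IsSymmetricProjection) ∧ (∀ k k', k ≠ k' → E k ∘ₗ E k' = 0) ∧
    ∑ k, E k = LinearMap.id

/-- The family of rank-one projections `|p_k⟩⟨p_k|` onto the vectors of an orthonormal basis. -/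
def basisPVM {κ : Type*} [Fintype κ] (p : OrthonormalBasis κ ℂ H) : κ → (H →ₗ[ℂ] H) :=
  fun k => (InnerProductSpace.rankOne ℂ (p k) (p k)).toLinearMap

/-- A family `(E_k)` with `∑ k, E_k† E_k ≤ 1`, i.e. a Kraus representation of a trace-nonincreasing
completely positive map. -/
def IsError {κ : Type*} [Fintype κ] (E : κ → (H →ₗ[ℂ] H)) : Prop :=
  (LinearMap.id - ∑ k, LinearMap.adjoint (E k) ∘ₗ E k).IsPositive

/-- The map `ρ ↦ ∑ k, E_k ρ E_k†`. -/
def errorMap {κ : Type*} [Fintype κ] (E : κ → (H →ₗ[ℂ] H)) (ρ : H →ₗ[ℂ] H) : H →ₗ[ℂ] H :=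
  ∑ k, E k ∘ₗ ρ ∘ₗ LinearMap.adjoint (E k)

/-- A density operator: positive with trace one. -/
def IsDensity (ρ : H →ₗ[ℂ] H) : Prop :=
  ρ.IsPositive ∧ LinearMap.trace ℂ H ρ = 1

/-- Positivity of an `N × N` matrix of operators on `H`, as an operator on `H ⊕ ⋯ ⊕ H`
(`N` summands). -/
def BlockPositive {N : ℕ} (A : Matrix (Fin N) (Fin N) (H →ₗ[ℂ] H)) : Prop :=
  ∀ x : Fin N → H, (0 : ℂ) ≤ ∑ i, ∑ j, ⟪x i, A i j (x j)⟫_ℂ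

/-- Complete positivity: for every `N`, applying `R` entrywise maps positive `N × N` operator
matrices to positive ones. -/
def IsCompletelyPositive (R : (H →ₗ[ℂ] H) →ₗ[ℂ] (H →ₗ[ℂ] H)) : Prop :=
  ∀ (N : ℕ) (A : Matrix (Fin N) (Fin N) (H →ₗ[ℂ] H)), BlockPositive A → BlockPositive (A.map R)

/-- `R` preserves the trace. -/
def IsTracePreserving (R : (H →ₗ[ℂ] H) →ₗ[ℂ] (H →ₗ[ℂ] H)) : Prop :=
  ∀ ρ, LinearMap.trace ℂ H (R ρ) = LinearMap.trace ℂ H ρ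

/-- `C` is a `(D, D')` quantum code: a `D'`-dimensional subspace of a `D`-dimensional space. -/
def IsQuantumCode (C : Submodule ℂ H) (D D' : ℕ) : Prop :=
  Module.finrank ℂ H = D ∧ Module.finrank ℂ C = D'

/-- `C` is a quantum error-correcting code against the error `(E_k)`: some trace-preserving
completely positive `R` satisfies `R (ε ρ) ∝ ρ` for all density operators `ρ` on `C`, where
`ε ρ = ∑ k, E_k ρ E_k†`.  A density operator on `C` is one on `H` whose range lies in `C`. -/
def IsQECC {κ : Type*} [Fintype κ] (C : Submodule ℂ H) (E : κ → (H →ₗ[ℂ] H)) : Prop :=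
  IsError E ∧
    ∃ R : (H →ₗ[ℂ] H) →ₗ[ℂ] (H →ₗ[ℂ] H), IsCompletelyPositive R ∧ IsTracePreserving R ∧
      ∀ ρ, IsDensity ρ → LinearMap.range ρ ≤ C →
        ∃ c : ℝ, 0 ≤ c ∧ R (errorMap E ρ) = (c : ℂ) • ρ

/-- The measurement that distinguishes the subspaces `E_k C`: the outcome `some k` corresponds to
the orthogonal projection onto `E_k C`, the outcome `none` to the rest, `1 - ∑ k, Proj (E_k C)`. -/
def distinguishingMeasurement {κ : Type*} [Fintype κ] (C : Submodule ℂ H)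
    (E : κ → (H →ₗ[ℂ] H)) : Option κ → (H →ₗ[ℂ] H)
  | some k => (C.map (E k)).starProjection.toLinearMap
  | none => LinearMap.id - ∑ k, (C.map (E k)).starProjection.toLinearMap

end General

/-! ### The mean king's problem -/

section Bipartite

variable {HA HK : Type*} [NormedAddCommGroup HA] [InnerProductSpace ℂ HA] [FiniteDimensional ℂ HA]
  [NormedAddCommGroup HK] [InnerProductSpace ℂ HK] [FiniteDimensional ℂ HK]

/-- The operator `I ⊗ L` on `H_A ⊗ H_K`. -/
def ext (HA : Type*) [NormedAddCommGroup HA] [InnerProductSpace ℂ HA]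
    (L : HK →ₗ[ℂ] HK) : (HA ⊗[ℂ] HK) →ₗ[ℂ] (HA ⊗[ℂ] HK) :=
  LinearMap.lTensor HA L

/-- The joint probability, for the initial state `ψ`, that the king obtains the outcome of the
measurement operator `M` on `H_K` and then Alice obtains the outcome of the POVM element `E`:
`⟨(I ⊗ M) ψ, E (I ⊗ M) ψ⟩ = tr (E (I ⊗ M) |ψ⟩⟨ψ| (I ⊗ M)†)`. -/
def jointProb (ψ : HA ⊗[ℂ] HK) (M : HK →ₗ[ℂ] HK)
    (E : (HA ⊗[ℂ] HK) →ₗ[ℂ] (HA ⊗[ℂ] HK)) : ℝ :=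
  (⟪ext HA M ψ, E (ext HA M ψ)⟫_ℂ).re

/-- The initial state `ψ` and Alice's measurement `E` solve the mean king's problem for the king's
measurements `M J = (M J i)_i`: from her outcome `k` and the king's choice `J`, Alice can guess the
king's outcome `i`, correctly whenever `i` and `k` occur with nonzero probability. -/
def SolvesMeanKing {n m : ℕ} {κ : Type*} [Fintype κ] (M : Fin n → Fin m → (HK →ₗ[ℂ] HK))
    (ψ : HA ⊗[ℂ] HK) (E : κ → ((HA ⊗[ℂ] HK) →ₗ[ℂ] (HA ⊗[ℂ] HK))) : Prop :=
  ‖ψ‖ = 1 ∧ IsPOVM E ∧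
    ∃ guess : κ → Fin n → Fin m, ∀ J i k, jointProb ψ (M J i) (E k) ≠ 0 → guess k J = i

/-- The Schmidt-form state `∑ j, η_j ψ_j ⊗ φ_j`. -/
def schmidtState {d : ℕ} (η : Fin d → ℝ) (ψ : OrthonormalBasis (Fin d) ℂ HA)
    (φ : OrthonormalBasis (Fin d) ℂ HK) : HA ⊗[ℂ] HK :=
  ∑ j, (η j : ℂ) • (ψ j ⊗ₜ[ℂ] φ j)

/-- The error operators `(L_k)` on `H_K` associated with a state `Ψ` and the king's measurements:
`∑ k, L_k† L_k ≤ 1`; for each `J` the index sets `X J i` are disjoint and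
`M J i = ∑ k ∈ X J i, f J i k • L_k` for some coefficients `f`; and
`⟨(I ⊗ L_k) Ψ, (I ⊗ L_k') Ψ⟩ = (α / d) δ_{kk'}` for some `α > 0`. -/
structure IsKingError {n m d : ℕ} (M : Fin n → Fin m → (HK →ₗ[ℂ] HK)) (Ψ : HA ⊗[ℂ] HK)
    (L : Fin (d ^ 2) → (HK →ₗ[ℂ] HK)) (X : Fin n → Fin m → Finset (Fin (d ^ 2))) : Prop where
  isError : IsError L
  disjoint : ∀ J i i', i ≠ i' → Disjoint (X J i) (X J i')
  decomp : ∃ f : Fin n → Fin m → Fin (d ^ 2) → ℂ, ∀ J i, M J i = ∑ k ∈ X J i, f J i k • L k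
  ortho : ∃ α : ℝ, 0 < α ∧ ∀ k k', ⟪ext HA (L k) Ψ, ext HA (L k') Ψ⟫_ℂ =
    if k = k' then ((α / d : ℝ) : ℂ) else 0

/-- For `l < ⌊dA / d⌋` and `j < d`, the index `d * l + j < dA`. -/
def codeIndex {d dA : ℕ} (l : Fin (dA / d)) (j : Fin d) : Fin dA :=
  ⟨d * l + j, by
    have h1 : d * ((l : ℕ) + 1) ≤ d * (dA / d) := Nat.mul_le_mul_left d l.isLt
    have h2 : d * (dA / d) ≤ dA := Nat.mul_div_le dA d
    have h3 := j.isLt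
    rw [Nat.mul_add] at h1
    omega⟩

/-- The states `∑ j, η_j ξ_{d l + j} ⊗ φ_j`, for `l = 0, …, ⌊dA / d⌋ - 1` (so `l` here is the
usual index minus one). -/
def codeVector {d dA : ℕ} (η : Fin d → ℝ) (ξ : OrthonormalBasis (Fin dA) ℂ HA)
    (φ : OrthonormalBasis (Fin d) ℂ HK) (l : Fin (dA / d)) : HA ⊗[ℂ] HK :=
  ∑ j, (η j : ℂ) • (ξ (codeIndex l j) ⊗ₜ[ℂ] φ j)

/-- The code spanned by the states `codeVector η ξ φ l`. -/
def code {d dA : ℕ} (η : Fin d → ℝ) (ξ : OrthonormalBasis (Fin dA) ℂ HA)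
    (φ : OrthonormalBasis (Fin d) ℂ HK) : Submodule ℂ (HA ⊗[ℂ] HK) :=
  Submodule.span ℂ (Set.range (codeVector η ξ φ))

end Bipartite

end

end MeanKing

namespace MeanKing

/-! ### Orthogonal errors on a code: projections, recovery, error correction. -/

section Operators

variable {H : Type*} [NormedAddCommGroup H] [InnerProductSpace ℂ H]
  {κ : Type*} [Fintype κ]

/-! Since all `η j` are positive, `L ↦ (I ⊗ L) Ψ` is a linear bijection from operators onto
bipartite vectors (`extApply_schmidtState_bijective`). Pulling the basis `p` back and rescaling
gives the `L k`; expanding `(I ⊗ M J i) Ψ` in `p` then expands `M J i` in them. The indices that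
occur are Alice's possible outcomes, and a correct guess forces them to be disjoint for different
`i`.

For the code, every spanning state has the Schmidt weights `η` and the vectors `φ` of `Ψ`, while
different spanning states occupy orthogonal blocks of `ξ`. Hence `⟪(I ⊗ L) x, (I ⊗ L') y⟫` on the
code is `⟪x, y⟫` times the value at `Ψ` (`inner_ext_of_mem_code`), and orthogonality at `Ψ` becomes
the diagonal Knill–Laflamme condition `IsOrthogonalError`. The errors are then multiples of
isometries on the code with orthogonal ranges: they can be identified and undone (`isQECC`), and
identifying `k` reveals the `i` with `k ∈ X J i`. -/

theorem comp_sum_operators (T : H →ₗ[ℂ] H) (S : κ → (H →ₗ[ℂ] H)) :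
    T ∘ₗ ∑ k, S k = ∑ k, T ∘ₗ S k := by
  ext v
  simp

theorem sum_operators_comp (S : κ → (H →ₗ[ℂ] H)) (T : H →ₗ[ℂ] H) :
    (∑ k, S k) ∘ₗ T = ∑ k, S k ∘ₗ T := by
  ext v
  simp

theorem isPVM_isPOVM {E : κ → (H →ₗ[ℂ] H)} (hE : IsPVM E) : IsPOVM E :=
  ⟨fun k => (hE.1 k).isPositive, hE.2.2⟩

/-- The Knill–Laflamme condition with a diagonal scalar matrix: the operators `E_k` multiply inner
products on `C` by `β` and have pairwise orthogonal ranges on `C`. -/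
def IsOrthogonalError {κ : Type*} (C : Submodule ℂ H) (E : κ → (H →ₗ[ℂ] H)) (β : ℝ) : Prop :=
  (∀ k, ∀ x ∈ C, ∀ y ∈ C, ⟪E k x, E k y⟫_ℂ = β * ⟪x, y⟫_ℂ) ∧
    ∀ k k', k ≠ k' → ∀ x ∈ C, ∀ y ∈ C, ⟪E k x, E k' y⟫_ℂ = 0

variable [FiniteDimensional ℂ H]

theorem isError_iff {E : κ → (H →ₗ[ℂ] H)} :
    IsError E ↔ ∀ x, ∑ k, ‖E k x‖ ^ 2 ≤ ‖x‖ ^ 2 := by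
  have hs : (LinearMap.id - ∑ k, LinearMap.adjoint (E k) ∘ₗ E k).IsSymmetric :=
    LinearMap.IsSymmetric.id.sub
      (LinearMap.isPositive_sum _ fun k _ =>
        LinearMap.isPositive_adjoint_comp_self (E k)).isSymmetric
  have key : ∀ x, RCLike.re ⟪(LinearMap.id - ∑ k, LinearMap.adjoint (E k) ∘ₗ E k : H →ₗ[ℂ] H) x, x⟫_ℂ
      = ‖x‖ ^ 2 - ∑ k, ‖E k x‖ ^ 2 := by
    intro x
    rw [LinearMap.sub_apply, inner_sub_left, map_sub, LinearMap.sum_apply, sum_inner, map_sum]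
    simp only [LinearMap.id_apply, LinearMap.comp_apply, LinearMap.adjoint_inner_left,
      inner_self_eq_norm_sq]
  refine ⟨fun h x => ?_, fun h => ⟨hs, fun x => ?_⟩⟩
  · have := h.2 x
    rw [key] at this
    linarith
  · rw [key]
    linarith [h x]

theorem exists_isError_smul (T : κ → (H →ₗ[ℂ] H)) :
    ∃ c : ℝ, 0 < c ∧ IsError fun k => (c : ℂ) • T k := by
  have hS : 0 ≤ ∑ k, ‖LinearMap.toContinuousLinearMap (T k)‖ ^ 2 :=
    Finset.sum_nonneg fun k _ => by positivity
  set S := ∑ k, ‖LinearMap.toContinuousLinearMap (T k)‖ ^ 2 with hSdef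
  -- The summand `1` keeps the scale finite and positive even if every `T k` vanishes.
  refine ⟨√(1 + S)⁻¹, by positivity, isError_iff.2 fun x => ?_⟩
  have h1 : ∑ k, ‖T k x‖ ^ 2 ≤ S * ‖x‖ ^ 2 := by
    rw [hSdef, Finset.sum_mul]
    refine Finset.sum_le_sum fun k _ => ?_
    rw [← mul_pow]
    exact pow_le_pow_left₀ (norm_nonneg _)
      ((LinearMap.toContinuousLinearMap (T k)).le_opNorm x) 2
  have h2 : ∀ k, ‖(((√(1 + S)⁻¹ : ℝ) : ℂ) • T k) x‖ ^ 2 = (1 + S)⁻¹ * ‖T k x‖ ^ 2 := by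
    intro k
    rw [LinearMap.smul_apply, norm_smul, mul_pow, Complex.norm_real, Real.norm_eq_abs, sq_abs,
      Real.sq_sqrt (by positivity)]
  simp only [h2]
  rw [← Finset.mul_sum, inv_mul_le_iff₀ (by positivity)]
  nlinarith [sq_nonneg ‖x‖]

/-- The Kraus form `ρ ↦ ∑ k, A_k ρ A_k†` as a linear map. -/
noncomputable def krausMap (A : κ → (H →ₗ[ℂ] H)) : (H →ₗ[ℂ] H) →ₗ[ℂ] (H →ₗ[ℂ] H) where
  toFun := errorMap A
  map_add' ρ σ := by
    simp [errorMap, LinearMap.add_comp, LinearMap.comp_add, Finset.sum_add_distrib]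
  map_smul' c ρ := by
    simp [errorMap, LinearMap.smul_comp, LinearMap.comp_smul, Finset.smul_sum]

theorem krausMap_apply (A : κ → (H →ₗ[ℂ] H)) (ρ : H →ₗ[ℂ] H) :
    krausMap A ρ = ∑ k, A k ∘ₗ ρ ∘ₗ LinearMap.adjoint (A k) := rfl

/-- Moving each `A k` onto the test vectors leaves a sum of the original block form evaluated at `A
k† x`. -/
theorem isCompletelyPositive_krausMap (A : κ → (H →ₗ[ℂ] H)) :
    IsCompletelyPositive (krausMap A) := by
  intro N B hB x
  have h : ∑ i, ∑ j, ⟪x i, (B.map (krausMap A)) i j (x j)⟫_ℂ =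
      ∑ k, ∑ i, ∑ j, ⟪LinearMap.adjoint (A k) (x i), B i j (LinearMap.adjoint (A k) (x j))⟫_ℂ := by
    simp only [Matrix.map_apply, krausMap_apply, LinearMap.sum_apply, inner_sum,
      LinearMap.comp_apply, LinearMap.adjoint_inner_left]
    exact (Finset.sum_comm.trans (Finset.sum_congr rfl fun i _ => Finset.sum_comm)).symm
  rw [h]
  exact Finset.sum_nonneg fun k _ => hB _

theorem isTracePreserving_krausMap {A : κ → (H →ₗ[ℂ] H)} (hA : IsMeasurement A) :
    IsTracePreserving (krausMap A) := by
  intro ρ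
  have h : ∀ k, LinearMap.trace ℂ H (A k ∘ₗ ρ ∘ₗ LinearMap.adjoint (A k)) =
      LinearMap.trace ℂ H (ρ ∘ₗ (LinearMap.adjoint (A k) ∘ₗ A k)) := by
    intro k
    rw [LinearMap.trace_comp_comm', LinearMap.comp_assoc]
  simp only [krausMap_apply, map_sum, h]
  rw [← map_sum, ← comp_sum_operators, hA, LinearMap.comp_id]

namespace IsOrthogonalError

variable {κ : Type*} {C : Submodule ℂ H} {E : κ → (H →ₗ[ℂ] H)} {β : ℝ}

theorem isOrtho (h : IsOrthogonalError C E β) {k k' : κ} (hk : k ≠ k') :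
    C.map (E k) ⟂ C.map (E k') := by
  rw [Submodule.isOrtho_iff_inner_eq]
  rintro _ ⟨x, hx, rfl⟩ _ ⟨y, hy, rfl⟩
  exact h.2 k k' hk x hx y hy

/-- With `V = β^{-1/2} E k` isometric on `C`, the projection onto `V C` is `V P_C V†`. -/
theorem starProjection_map (h : IsOrthogonalError C E β) (hβ : 0 < β) (k : κ) :
    (C.map (E k)).starProjection.toLinearMap =
      ((β⁻¹ : ℝ) : ℂ) •
        (E k ∘ₗ C.starProjection.toLinearMap ∘ₗ LinearMap.adjoint (E k)) := by
  have hβ' : (β : ℂ) ≠ 0 := by exact_mod_cast hβ.ne'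
  ext v
  refine Submodule.eq_starProjection_of_mem_of_inner_eq_zero ?_ ?_
  · exact Submodule.smul_mem _ _
      (Submodule.mem_map_of_mem (Submodule.starProjection_apply_mem _ _))
  · rintro _ ⟨y, hy, rfl⟩
    have h1 := Submodule.starProjection_inner_eq_zero (K := C) (LinearMap.adjoint (E k) v) y hy
    rw [inner_sub_left, LinearMap.adjoint_inner_left] at h1
    simp only [LinearMap.smul_apply, LinearMap.comp_apply, inner_sub_left, inner_smul_left,
      ContinuousLinearMap.coe_coe, Complex.conj_ofReal]
    rw [h.1 k _ (Submodule.starProjection_apply_mem _ _) y hy, Complex.ofReal_inv,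
      inv_mul_cancel_left₀ hβ']
    exact h1

theorem starProjection_map_apply_self (k : κ) {x : H} (hx : x ∈ C) :
    (C.map (E k)).starProjection (E k x) = E k x :=
  Submodule.starProjection_eq_self_iff.2 (Submodule.mem_map_of_mem hx)

theorem starProjection_map_apply_of_ne (h : IsOrthogonalError C E β) {k k' : κ} (hk : k ≠ k')
    {x : H} (hx : x ∈ C) : (C.map (E k)).starProjection (E k' x) = 0 := by
  rw [Submodule.starProjection_apply_eq_zero_iff]
  exact (h.isOrtho hk.symm) (Submodule.mem_map_of_mem hx)

theorem starProjection_comp (h : IsOrthogonalError C E β) {k k' : κ} (hk : k ≠ k') :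
    (C.map (E k)).starProjection.toLinearMap ∘ₗ (C.map (E k')).starProjection.toLinearMap = 0 := by
  ext v
  have := DFunLike.congr_fun ((h.isOrtho hk).starProjection_comp_starProjection) v
  simpa using this

variable [Fintype κ]

theorem sum_starProjection_map_apply (h : IsOrthogonalError C E β) (k : κ) {x : H} (hx : x ∈ C) :
    ∑ k', (C.map (E k')).starProjection (E k x) = E k x := by
  rw [Finset.sum_eq_single k (fun k' _ hk' => h.starProjection_map_apply_of_ne hk' hx) (by simp),
    starProjection_map_apply_self k hx]

theorem distinguishingMeasurement_none_apply (h : IsOrthogonalError C E β) (k : κ) {x : H}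
    (hx : x ∈ C) : distinguishingMeasurement C E none (E k x) = 0 := by
  simp [distinguishingMeasurement, h.sum_starProjection_map_apply k hx]

theorem starProjection_comp_sum (h : IsOrthogonalError C E β) (k : κ) :
    (C.map (E k)).starProjection.toLinearMap ∘ₗ
        ∑ k', (C.map (E k')).starProjection.toLinearMap =
      (C.map (E k)).starProjection.toLinearMap := by
  rw [comp_sum_operators, Finset.sum_eq_single k
    (fun k' _ hk' => h.starProjection_comp hk'.symm) (by simp)]
  exact (Submodule.isSymmetricProjection_starProjection _).isIdempotentElem

theorem sum_comp_starProjection (h : IsOrthogonalError C E β) (k : κ) :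
    (∑ k', (C.map (E k')).starProjection.toLinearMap) ∘ₗ
        (C.map (E k)).starProjection.toLinearMap =
      (C.map (E k)).starProjection.toLinearMap := by
  rw [sum_operators_comp, Finset.sum_eq_single k
    (fun k' _ hk' => h.starProjection_comp hk') (by simp)]
  exact (Submodule.isSymmetricProjection_starProjection _).isIdempotentElem

theorem isPVM (h : IsOrthogonalError C E β) : IsPVM (distinguishingMeasurement C E) := by
  have hsum : (∑ k', (C.map (E k')).starProjection.toLinearMap) ∘ₗ
      (∑ k', (C.map (E k')).starProjection.toLinearMap) =
      ∑ k', (C.map (E k')).starProjection.toLinearMap := by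
    nth_rw 1 [sum_operators_comp]
    exact Finset.sum_congr rfl fun k _ => h.starProjection_comp_sum k
  refine ⟨?_, ?_, ?_⟩
  · rintro (_ | k)
    · refine ⟨?_, ?_⟩
      · exact (IsIdempotentElem.one_sub (a := (∑ k, (C.map (E k)).starProjection.toLinearMap :
          Module.End ℂ H)) hsum)
      · exact LinearMap.IsSymmetric.id.sub
          (LinearMap.isPositive_sum _ fun k _ =>
            (Submodule.isSymmetricProjection_starProjection (C.map (E k))).isPositive).isSymmetric
    · exact Submodule.isSymmetricProjection_starProjection _
  · rintro (_ | k) (_ | k') hk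
    · exact absurd rfl hk
    · simp [distinguishingMeasurement, LinearMap.sub_comp, h.sum_comp_starProjection]
    · simp [distinguishingMeasurement, LinearMap.comp_sub, h.starProjection_comp_sum]
    · exact h.starProjection_comp fun e => hk (by rw [e])
  · rw [Fintype.sum_option]
    simp [distinguishingMeasurement]

/-- The Kraus operators of the recovery: `β^{-1/2} P_C E_k†` and the projection onto the orthogonal
complement of all the `E_k C`. -/
noncomputable def recovery (C : Submodule ℂ H) (E : κ → (H →ₗ[ℂ] H)) (β : ℝ) :
    Option κ → (H →ₗ[ℂ] H)
  | some k => ((√β⁻¹ : ℝ) : ℂ) • (C.starProjection.toLinearMap ∘ₗ LinearMap.adjoint (E k))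
  | none => distinguishingMeasurement C E none

theorem adjoint_starProjection (C : Submodule ℂ H) :
    LinearMap.adjoint C.starProjection.toLinearMap = C.starProjection.toLinearMap :=
  (Submodule.isSymmetricProjection_starProjection C).isPositive.adjoint_eq

/-- By `starProjection_map`, the products `A† A` of the recovery operators are exactly the elements
of the distinguishing PVM. -/
theorem isMeasurement_recovery (h : IsOrthogonalError C E β) (hβ : 0 < β) :
    IsMeasurement (recovery C E β) := by
  have hsome : ∀ k, LinearMap.adjoint (recovery C E β (some k)) ∘ₗ recovery C E β (some k) =
      distinguishingMeasurement C E (some k) := by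
    intro k
    have hP : C.starProjection.toLinearMap ∘ₗ C.starProjection.toLinearMap =
      C.starProjection.toLinearMap :=
      (Submodule.isSymmetricProjection_starProjection C).isIdempotentElem
    have hr : ((√β⁻¹ : ℝ) : ℂ) * ((√β⁻¹ : ℝ) : ℂ) = ((β⁻¹ : ℝ) : ℂ) := by
      rw [← Complex.ofReal_mul, Real.mul_self_sqrt (inv_nonneg.2 hβ.le)]
    change _ = (C.map (E k)).starProjection.toLinearMap
    rw [h.starProjection_map hβ, recovery, map_smulₛₗ, LinearMap.adjoint_comp,
      LinearMap.adjoint_adjoint, adjoint_starProjection, LinearMap.smul_comp,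
      LinearMap.comp_smul, smul_smul, Complex.conj_ofReal, hr, LinearMap.comp_assoc]
    rw [← LinearMap.comp_assoc (LinearMap.adjoint (E k)) C.starProjection.toLinearMap, hP]
  have hnone : LinearMap.adjoint (recovery C E β none) ∘ₗ recovery C E β none =
      distinguishingMeasurement C E none := by
    have := h.isPVM.1 none
    change LinearMap.adjoint (distinguishingMeasurement C E none) ∘ₗ
      distinguishingMeasurement C E none = _
    rw [this.isPositive.adjoint_eq]
    exact this.isIdempotentElem
  rw [IsMeasurement, ← h.isPVM.2.2]
  refine Finset.sum_congr rfl fun k _ => ?_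
  cases k with
  | none => exact hnone
  | some k => exact hsome k

theorem recovery_some_apply_self (h : IsOrthogonalError C E β) (hβ : 0 < β) (k : κ) {x : H}
    (hx : x ∈ C) : recovery C E β (some k) (E k x) = ((√β : ℝ) : ℂ) • x := by
  have h1 : C.starProjection (LinearMap.adjoint (E k) (E k x)) = (β : ℂ) • x := by
    refine (Submodule.eq_starProjection_of_mem_of_inner_eq_zero (C.smul_mem _ hx) ?_)
    intro y hy
    rw [inner_sub_left, LinearMap.adjoint_inner_left, h.1 k x hx y hy, inner_smul_left,
      Complex.conj_ofReal, sub_self]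
  simp only [recovery, LinearMap.smul_apply, LinearMap.comp_apply, ContinuousLinearMap.coe_coe, h1,
    smul_smul, ← Complex.ofReal_mul]
  congr 2
  rw [Real.sqrt_inv]
  nth_rw 2 [← Real.mul_self_sqrt hβ.le]
  rw [inv_mul_cancel_left₀ (Real.sqrt_pos.2 hβ).ne']

theorem recovery_some_apply_of_ne (h : IsOrthogonalError C E β) {k k' : κ} (hk : k ≠ k') {x : H}
    (hx : x ∈ C) : recovery C E β (some k) (E k' x) = 0 := by
  have h1 : C.starProjection (LinearMap.adjoint (E k) (E k' x)) = 0 := by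
    rw [Submodule.starProjection_apply_eq_zero_iff, Submodule.mem_orthogonal']
    intro y hy
    rw [LinearMap.adjoint_inner_left, h.2 k' k hk.symm x hx y hy]
  simp [recovery, h1]

theorem isQECC (h : IsOrthogonalError C E β) (hβ : 0 < β) (hE : IsError E) : IsQECC C E := by
  classical
  refine ⟨hE, krausMap (recovery C E β), isCompletelyPositive_krausMap _,
    isTracePreserving_krausMap (h.isMeasurement_recovery hβ), fun ρ hρ hC => ?_⟩
  -- Each error `E k` contributes `β • ρ`, through its own recovery operator alone.
  refine ⟨Fintype.card κ * β, by positivity, ?_⟩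
  have hρC : ∀ v, ρ v ∈ C := fun v => hC ⟨v, rfl⟩
  have hρa : LinearMap.adjoint ρ = ρ := hρ.1.adjoint_eq
  -- Self-adjointness of `ρ` carries the scalar action of `B` on `C` over to the right-hand factor.
  have hsand : ∀ (B : H →ₗ[ℂ] H) (b : ℝ), (∀ x ∈ C, B x = (b : ℂ) • x) →
      B ∘ₗ ρ ∘ₗ LinearMap.adjoint B = ((b * b : ℝ) : ℂ) • ρ := by
    intro B b hB
    have h1 : B ∘ₗ ρ = (b : ℂ) • ρ := by
      ext v
      exact hB _ (hρC v)
    have h2 : ρ ∘ₗ LinearMap.adjoint B = (b : ℂ) • ρ := by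
      have := congrArg LinearMap.adjoint h1
      rwa [LinearMap.adjoint_comp, map_smulₛₗ, hρa, Complex.conj_ofReal] at this
    rw [h2, LinearMap.comp_smul, h1, smul_smul, Complex.ofReal_mul]
  have hterm : ∀ (a : Option κ) (k : κ),
      recovery C E β a ∘ₗ (E k ∘ₗ ρ ∘ₗ LinearMap.adjoint (E k)) ∘ₗ
        LinearMap.adjoint (recovery C E β a) = if a = some k then (β : ℂ) • ρ else 0 := by
    intro a k
    have hre : recovery C E β a ∘ₗ (E k ∘ₗ ρ ∘ₗ LinearMap.adjoint (E k)) ∘ₗ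
        LinearMap.adjoint (recovery C E β a) = (recovery C E β a ∘ₗ E k) ∘ₗ ρ ∘ₗ
          LinearMap.adjoint (recovery C E β a ∘ₗ E k) := by
      rw [LinearMap.adjoint_comp]
      rfl
    rw [hre]
    split_ifs with hak
    · rw [hak, hsand _ (√β) fun x hx => (LinearMap.comp_apply _ _ _).trans
        (h.recovery_some_apply_self hβ k hx), Real.mul_self_sqrt hβ.le]
    · rw [hsand _ 0]
      · simp
      · intro x hx
        rw [Complex.ofReal_zero, zero_smul, LinearMap.comp_apply]
        cases a with
        | none => exact h.distinguishingMeasurement_none_apply k hx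
        | some k' => exact h.recovery_some_apply_of_ne (fun e => hak (by rw [e])) hx
  change ∑ a, recovery C E β a ∘ₗ errorMap E ρ ∘ₗ LinearMap.adjoint (recovery C E β a) = _
  simp only [errorMap, sum_operators_comp, comp_sum_operators, hterm]
  rw [Finset.sum_comm]
  simp only [Finset.sum_ite_eq', Finset.mem_univ, if_true, Finset.sum_const, Finset.card_univ]
  rw [← Nat.cast_smul_eq_nsmul ℂ, smul_smul]
  push_cast
  rfl

end IsOrthogonalError

end Operators

/-! ### Schmidt-form states and the code they span. -/

section Schmidt

variable {HA HK : Type*} [NormedAddCommGroup HA] [InnerProductSpace ℂ HA]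
  [NormedAddCommGroup HK] [InnerProductSpace ℂ HK]
  {d dA : ℕ} {η : Fin d → ℝ}

theorem ext_tmul (L : HK →ₗ[ℂ] HK) (a : HA) (b : HK) : ext HA L (a ⊗ₜ[ℂ] b) = a ⊗ₜ[ℂ] L b := rfl

theorem ext_id (x : HA ⊗[ℂ] HK) : ext HA (LinearMap.id : HK →ₗ[ℂ] HK) x = x := by
  simp [ext]

theorem tensor_inner_smul_left (c : ℂ) (x y : HA ⊗[ℂ] HK) :
    ⟪c • x, y⟫_ℂ = (starRingEnd ℂ) c * ⟪x, y⟫_ℂ := inner_smul_left x y c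

theorem tensor_inner_smul_right (c : ℂ) (x y : HA ⊗[ℂ] HK) :
    ⟪x, c • y⟫_ℂ = c * ⟪x, y⟫_ℂ := inner_smul_right x y c

theorem exists_sum_tmul (ξ : OrthonormalBasis (Fin dA) ℂ HA) (x : HA ⊗[ℂ] HK) :
    ∃ y : Fin dA → HK, x = ∑ a, ξ a ⊗ₜ[ℂ] y a := by
  induction x using TensorProduct.induction_on with
  | zero => exact ⟨0, by simp⟩
  | tmul u v =>
    refine ⟨fun a => ⟪ξ a, u⟫_ℂ • v, ?_⟩
    simp_rw [← TensorProduct.smul_tmul, ← TensorProduct.sum_tmul]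
    rw [ξ.sum_repr' u]
  | add x y hx hy =>
    obtain ⟨f, rfl⟩ := hx
    obtain ⟨g, rfl⟩ := hy
    exact ⟨f + g, by simp [TensorProduct.tmul_add, Finset.sum_add_distrib]⟩

theorem norm_sq_sum_tmul (ξ : OrthonormalBasis (Fin dA) ℂ HA) (y : Fin dA → HK) :
    ‖∑ a, ξ a ⊗ₜ[ℂ] y a‖ ^ 2 = ∑ a, ‖y a‖ ^ 2 := by
  have h : ⟪∑ a, ξ a ⊗ₜ[ℂ] y a, ∑ a, ξ a ⊗ₜ[ℂ] y a⟫_ℂ = ∑ a, ⟪y a, y a⟫_ℂ := by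
    simp [sum_inner, inner_sum, ξ.inner_eq_ite, -inner_self_eq_norm_sq_to_K]
  rw [← inner_self_eq_norm_sq (𝕜 := ℂ), h, map_sum]
  simp only [inner_self_eq_norm_sq]

/-- The linear map `L ↦ (I ⊗ L) Ψ`. -/
noncomputable def extApply (Ψ : HA ⊗[ℂ] HK) : (HK →ₗ[ℂ] HK) →ₗ[ℂ] HA ⊗[ℂ] HK :=
  LinearMap.applyₗ Ψ ∘ₗ LinearMap.lTensorHom HA

theorem extApply_apply (Ψ : HA ⊗[ℂ] HK) (L : HK →ₗ[ℂ] HK) : extApply Ψ L = ext HA L Ψ := rfl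

/-- The sesquilinear form `(L, L') ↦ ∑ j, η_j² ⟪L φ_j, L' φ_j⟫` on operators. -/
noncomputable def schmidtForm (η : Fin d → ℝ) (φ : OrthonormalBasis (Fin d) ℂ HK)
    (L L' : HK →ₗ[ℂ] HK) : ℂ :=
  ∑ j, ((η j ^ 2 : ℝ) : ℂ) * ⟪L (φ j), L' (φ j)⟫_ℂ

theorem inner_ext_codeVector (ξ : OrthonormalBasis (Fin dA) ℂ HA)
    (φ : OrthonormalBasis (Fin d) ℂ HK) (L L' : HK →ₗ[ℂ] HK) (l l' : Fin (dA / d)) :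
    ⟪ext HA L (codeVector η ξ φ l), ext HA L' (codeVector η ξ φ l')⟫_ℂ =
      if l = l' then schmidtForm η φ L L' else 0 := by
  -- Division by `d` recovers the block `l` and the position `j`.
  have hidx : ∀ j j' : Fin d, codeIndex l j = codeIndex l' j' ↔ l = l' ∧ j = j' := by
    intro j j'
    refine ⟨fun h => ?_, by rintro ⟨rfl, rfl⟩; rfl⟩
    have h1 : d * (l : ℕ) + j = d * (l' : ℕ) + j' := congrArg Fin.val h
    have hd : 0 < d := j.pos
    have h2 := congrArg (· / d) h1
    simp only [Nat.mul_add_div hd, Nat.div_eq_of_lt j.isLt, Nat.div_eq_of_lt j'.isLt,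
      Nat.add_zero] at h2
    rw [h2] at h1
    exact ⟨Fin.ext h2, Fin.ext (by omega)⟩
  simp only [codeVector, map_sum, map_smul, ext_tmul, sum_inner, inner_sum, tensor_inner_smul_left,
    tensor_inner_smul_right, TensorProduct.inner_tmul, ξ.inner_eq_ite, hidx, Complex.conj_ofReal]
  split_ifs with hl
  · simp [hl, schmidtForm, sq, mul_assoc]
  · simp [hl]

theorem inner_ext_schmidtState (ψ : OrthonormalBasis (Fin d) ℂ HA)
    (φ : OrthonormalBasis (Fin d) ℂ HK) (L L' : HK →ₗ[ℂ] HK) :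
    ⟪ext HA L (schmidtState η ψ φ), ext HA L' (schmidtState η ψ φ)⟫_ℂ = schmidtForm η φ L L' := by
  simp only [schmidtState, map_sum, map_smul, ext_tmul, sum_inner, inner_sum,
    tensor_inner_smul_left, tensor_inner_smul_right, TensorProduct.inner_tmul, ψ.inner_eq_ite,
    Complex.conj_ofReal]
  simp [schmidtForm, sq, mul_assoc]

theorem orthonormal_codeVector (hη : ∑ j, η j ^ 2 = 1) (ξ : OrthonormalBasis (Fin dA) ℂ HA)
    (φ : OrthonormalBasis (Fin d) ℂ HK) : Orthonormal ℂ (codeVector η ξ φ) := by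
  rw [orthonormal_iff_ite]
  intro l l'
  have h : schmidtForm η φ LinearMap.id LinearMap.id = 1 := by
    have : ∀ j, ⟪φ j, φ j⟫_ℂ = 1 := fun j => by simp
    simp only [schmidtForm, LinearMap.id_apply, this, mul_one]
    exact_mod_cast hη
  have := inner_ext_codeVector (η := η) ξ φ LinearMap.id LinearMap.id l l'
  rwa [ext_id, ext_id, h] at this

theorem inner_ext_of_mem_code (hη : ∑ j, η j ^ 2 = 1) (ξ : OrthonormalBasis (Fin dA) ℂ HA)
    (φ : OrthonormalBasis (Fin d) ℂ HK) (L L' : HK →ₗ[ℂ] HK) {x y : HA ⊗[ℂ] HK}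
    (hx : x ∈ code η ξ φ) (hy : y ∈ code η ξ φ) :
    ⟪ext HA L x, ext HA L' y⟫_ℂ = schmidtForm η φ L L' * ⟪x, y⟫_ℂ := by
  induction hx using Submodule.span_induction with
  | zero => simp
  | add u v _ _ hu hv => rw [map_add, inner_add_left, hu, hv, inner_add_left, mul_add]
  | smul c u _ hu => rw [map_smul, tensor_inner_smul_left, hu, tensor_inner_smul_left, mul_left_comm]
  | mem u hu =>
    obtain ⟨l, rfl⟩ := hu
    induction hy using Submodule.span_induction with
    | zero => simp
    | add u v _ _ hu hv => rw [map_add, inner_add_right, hu, hv, inner_add_right, mul_add]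
    | smul c u _ hu =>
      rw [map_smul, tensor_inner_smul_right, hu, tensor_inner_smul_right, mul_left_comm]
    | mem v hv =>
      obtain ⟨l', rfl⟩ := hv
      rw [inner_ext_codeVector, orthonormal_iff_ite.1 (orthonormal_codeVector hη ξ φ) l l']
      simp

variable [FiniteDimensional ℂ HA] [FiniteDimensional ℂ HK]

/-- Along an orthonormal basis of the first factor squared norms add, so the bound for `L` applies
to each component. -/
theorem isError_ext {κ : Type*} [Fintype κ] {L : κ → (HK →ₗ[ℂ] HK)} (hL : IsError L)
    (ξ : OrthonormalBasis (Fin dA) ℂ HA) : IsError fun k => ext HA (L k) := by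
  rw [isError_iff] at hL ⊢
  intro x
  obtain ⟨y, rfl⟩ := exists_sum_tmul ξ x
  simp only [map_sum, ext_tmul, norm_sq_sum_tmul]
  rw [Finset.sum_comm]
  exact Finset.sum_le_sum fun a _ => hL (y a)

theorem isQuantumCode_code (hη : ∑ j, η j ^ 2 = 1) (ξ : OrthonormalBasis (Fin dA) ℂ HA)
    (φ : OrthonormalBasis (Fin d) ℂ HK) : IsQuantumCode (code η ξ φ) (dA * d) (dA / d) := by
  constructor
  · rw [Module.finrank_tensorProduct, Module.finrank_eq_card_basis ξ.toBasis,
      Module.finrank_eq_card_basis φ.toBasis, Fintype.card_fin, Fintype.card_fin]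
  · rw [code, finrank_span_eq_card (orthonormal_codeVector hη ξ φ).linearIndependent,
      Fintype.card_fin]

/-- The image of `L` has squared norm `∑ j, η j ^ 2 * ‖L (φ j)‖ ^ 2`, which vanishes only for `L =
0`; both spaces have dimension `d ^ 2`. -/
theorem extApply_schmidtState_bijective (hη : ∀ j, 0 < η j) (ψ : OrthonormalBasis (Fin d) ℂ HA)
    (φ : OrthonormalBasis (Fin d) ℂ HK) :
    Function.Bijective (extApply (schmidtState η ψ φ)) := by
  have hinj : Function.Injective (extApply (schmidtState η ψ φ)) := by
    rw [← LinearMap.ker_eq_bot, LinearMap.ker_eq_bot']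
    intro L hL
    have h1 := inner_ext_schmidtState (η := η) ψ φ L L
    rw [← extApply_apply, hL, inner_zero_left, schmidtForm] at h1
    have h2 : ∑ j, η j ^ 2 * ‖L (φ j)‖ ^ 2 = 0 := by
      have h3 : ((∑ j, η j ^ 2 * ‖L (φ j)‖ ^ 2 : ℝ) : ℂ) = 0 := by
        rw [h1]
        push_cast
        exact Finset.sum_congr rfl fun j _ => by rw [inner_self_eq_norm_sq_to_K]; rfl
      exact_mod_cast h3
    rw [Finset.sum_eq_zero_iff_of_nonneg fun j _ => by positivity] at h2
    refine φ.toBasis.ext fun j => ?_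
    have h4 := h2 j (Finset.mem_univ j)
    have h5 : η j ≠ 0 := (hη j).ne'
    simpa [h5] using h4
  refine ⟨hinj, (LinearMap.injective_iff_surjective_of_finrank_eq_finrank ?_).1 hinj⟩
  rw [Module.finrank_linearMap, Module.finrank_tensorProduct,
    Module.finrank_eq_card_basis ψ.toBasis, Module.finrank_eq_card_basis φ.toBasis]

end Schmidt

/-! ### From solutions of the king's problem to errors, and back. -/

section King

variable {HA HK : Type*} [NormedAddCommGroup HA] [InnerProductSpace ℂ HA]
  [NormedAddCommGroup HK] [InnerProductSpace ℂ HK]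
  {n m d dA : ℕ} {M : Fin n → Fin m → (HK →ₗ[ℂ] HK)} {η : Fin d → ℝ}

theorem jointProb_basisPVM {κ : Type*} [Fintype κ] (Ψ : HA ⊗[ℂ] HK) (L : HK →ₗ[ℂ] HK)
    (p : OrthonormalBasis κ ℂ (HA ⊗[ℂ] HK)) (k : κ) :
    jointProb Ψ L (basisPVM p k) = ‖⟪p k, ext HA L Ψ⟫_ℂ‖ ^ 2 := by
  rw [jointProb, basisPVM, ContinuousLinearMap.coe_coe, InnerProductSpace.rankOne_apply,
    inner_smul_right, ← inner_conj_symm (ext HA L Ψ) (p k), RCLike.mul_conj]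
  norm_cast

variable [FiniteDimensional ℂ HA] [FiniteDimensional ℂ HK]

theorem exists_isKingError (hd : 0 < d) (hη : ∀ j, 0 < η j) (ψ : OrthonormalBasis (Fin d) ℂ HA)
    (φ : OrthonormalBasis (Fin d) ℂ HK) (p : OrthonormalBasis (Fin (d ^ 2)) ℂ (HA ⊗[ℂ] HK))
    (hsol : SolvesMeanKing M (schmidtState η ψ φ) (basisPVM p)) :
    ∃ (L : Fin (d ^ 2) → (HK →ₗ[ℂ] HK)) (X : Fin n → Fin m → Finset (Fin (d ^ 2))),
      IsKingError M (schmidtState η ψ φ) L X := by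
  classical
  obtain ⟨-, -, guess, hguess⟩ := hsol
  obtain ⟨hinj, hsurj⟩ := extApply_schmidtState_bijective hη ψ φ
  choose T hT using fun k => hsurj (p k)
  obtain ⟨c, hc, hL⟩ := exists_isError_smul T
  have hc' : (c : ℂ) ≠ 0 := by exact_mod_cast hc.ne'
  have hLp : ∀ k, ext HA ((c : ℂ) • T k) (schmidtState η ψ φ) = (c : ℂ) • p k := by
    intro k
    rw [← extApply_apply, map_smul, hT]
  -- `X J i` collects the outcomes of nonzero amplitude; `α = d c²` makes `α / d` the squared norm
  -- of `c • p k`.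
  refine ⟨fun k => (c : ℂ) • T k, fun J i => Finset.univ.filter fun k =>
    ⟪p k, ext HA (M J i) (schmidtState η ψ φ)⟫_ℂ ≠ 0, hL, ?_, ?_, d * c ^ 2, by positivity, ?_⟩
  · intro J i i' hii
    rw [Finset.disjoint_left]
    intro k hk hk'
    have hg : ∀ i₀, k ∈ Finset.univ.filter (fun k =>
        ⟪p k, ext HA (M J i₀) (schmidtState η ψ φ)⟫_ℂ ≠ 0) → guess k J = i₀ := by
      intro i₀ h
      refine hguess J i₀ k ?_
      rw [jointProb_basisPVM]
      exact pow_ne_zero 2 (norm_ne_zero_iff.2 (Finset.mem_filter.1 h).2)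
    exact hii ((hg i hk).symm.trans (hg i' hk'))
  · refine ⟨fun J i k => ⟪p k, ext HA (M J i) (schmidtState η ψ φ)⟫_ℂ * (c : ℂ)⁻¹,
      fun J i => hinj ?_⟩
    rw [extApply_apply, map_sum]
    simp only [map_smul, hT, smul_smul, inv_mul_cancel_right₀ hc']
    -- Indices outside `X J i` have zero amplitude, so this is the full expansion in `p`.
    rw [Finset.sum_filter_of_ne]
    · exact (p.sum_repr' _).symm
    · intro k _ hk h0
      rw [h0, zero_smul] at hk
      exact hk rfl
  · intro k k'
    have hd' : (d : ℝ) ≠ 0 := by exact_mod_cast hd.ne'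
    rw [hLp, hLp, tensor_inner_smul_left, tensor_inner_smul_right, p.inner_eq_ite,
      mul_div_cancel_left₀ _ hd', Complex.conj_ofReal]
    split_ifs
    · push_cast
      ring
    · simp

theorem isOrthogonalError_of_isKingError {HA' : Type*} [NormedAddCommGroup HA']
    [InnerProductSpace ℂ HA'] [FiniteDimensional ℂ HA']
    (hd : 0 < d) (hη : ∑ j, η j ^ 2 = 1) {ψ : OrthonormalBasis (Fin d) ℂ HA}
    {φ : OrthonormalBasis (Fin d) ℂ HK} {L : Fin (d ^ 2) → (HK →ₗ[ℂ] HK)}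
    {X : Fin n → Fin m → Finset (Fin (d ^ 2))}
    (hL : IsKingError M (schmidtState η ψ φ) L X) (ξ : OrthonormalBasis (Fin dA) ℂ HA') :
    ∃ β : ℝ, 0 < β ∧ IsOrthogonalError (code η ξ φ) (fun k => ext HA' (L k)) β := by
  obtain ⟨α, hα, ho⟩ := hL.ortho
  simp only [inner_ext_schmidtState] at ho
  refine ⟨α / d, by positivity, ?_, ?_⟩
  · intro k x hx y hy
    rw [inner_ext_of_mem_code hη ξ φ _ _ hx hy, ho, if_pos rfl]
  · intro k k' hk x hx y hy
    rw [inner_ext_of_mem_code hη ξ φ _ _ hx hy, ho, if_neg hk, zero_mul]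

/-- The state after outcome `i` lies in the sum of the `(I ⊗ L k) C` with `k ∈ X J i`, so only these
`k` can be observed, and disjointness makes `i` unique. -/
theorem solvesMeanKing_distinguishingMeasurement {C : Submodule ℂ (HA ⊗[ℂ] HK)}
    {κ : Type*} [Fintype κ] {L : κ → (HK →ₗ[ℂ] HK)} {X : Fin n → Fin m → Finset κ} {β : ℝ}
    (h : IsOrthogonalError C (fun k => ext HA (L k)) β)
    (hX : ∀ J i i', i ≠ i' → Disjoint (X J i) (X J i'))
    {f : Fin n → Fin m → κ → ℂ} (hf : ∀ J i, M J i = ∑ k ∈ X J i, f J i k • L k)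
    (hm : Fin n → Nonempty (Fin m)) {χ : HA ⊗[ℂ] HK} (hχ : χ ∈ C) (hχ1 : ‖χ‖ = 1) :
    SolvesMeanKing M χ (distinguishingMeasurement C fun k => ext HA (L k)) := by
  classical
  refine ⟨hχ1, isPVM_isPOVM h.isPVM, ?_⟩
  have hM : ∀ J i, ext HA (M J i) χ = ∑ k ∈ X J i, f J i k • ext HA (L k) χ := by
    intro J i
    rw [← extApply_apply, hf, map_sum]
    simp only [map_smul, extApply_apply]
  have hmem : ∀ J i k, jointProb χ (M J i)
      (distinguishingMeasurement C (fun k => ext HA (L k)) (some k)) ≠ 0 → k ∈ X J i := by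
    intro J i k
    contrapose!
    intro hk
    have h0 : (C.map (ext HA (L k))).starProjection (ext HA (M J i) χ) = 0 := by
      rw [hM, map_sum]
      refine Finset.sum_eq_zero fun k' hk' => ?_
      rw [map_smul, h.starProjection_map_apply_of_ne (fun e : k = k' => hk (e ▸ hk')) hχ, smul_zero]
    rw [jointProb, distinguishingMeasurement, ContinuousLinearMap.coe_coe, h0, inner_zero_right,
      Complex.zero_re]
  have hnone : ∀ J i, jointProb χ (M J i)
      (distinguishingMeasurement C (fun k => ext HA (L k)) none) = 0 := by
    intro J i
    have h0 : distinguishingMeasurement C (fun k => ext HA (L k)) none (ext HA (M J i) χ) = 0 := by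
      rw [hM, map_sum]
      refine Finset.sum_eq_zero fun k' _ => ?_
      rw [map_smul, h.distinguishingMeasurement_none_apply k' hχ, smul_zero]
    rw [jointProb, h0, inner_zero_right, Complex.zero_re]
  have hguess : ∀ (a : Option κ) (J : Fin n), ∃ g : Fin m, ∀ i, jointProb χ (M J i)
      (distinguishingMeasurement C (fun k => ext HA (L k)) a) ≠ 0 → g = i := by
    rintro (_ | k) J
    -- This outcome never occurs, so any guess will do.
    · exact ⟨(hm J).some, fun i hi => absurd (hnone J i) hi⟩
    · by_cases hex : ∃ i, k ∈ X J i
      · obtain ⟨i, hi⟩ := hex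
        refine ⟨i, fun i' hi' => ?_⟩
        by_contra hne
        exact Finset.disjoint_left.1 (hX J i i' hne) hi (hmem J i' k hi')
      · exact ⟨(hm J).some, fun i hi => absurd ⟨i, hmem J i k hi⟩ hex⟩
  choose g hg using hguess
  exact ⟨g, fun J i a => hg a J i⟩

end King

end MeanKing

theorem mainTheorem1 {HA : Type*} {HK : Type*}
    [NormedAddCommGroup HA] [InnerProductSpace ℂ HA] [FiniteDimensional ℂ HA]
    [NormedAddCommGroup HK] [InnerProductSpace ℂ HK] [FiniteDimensional ℂ HK]
    {n m d : ℕ}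
    (M : Fin n → Fin m → (HK →ₗ[ℂ] HK)) (hM : ∀ J, MeanKing.IsMeasurement (M J))
    (η : Fin d → ℝ) (hη : ∀ j, 0 < η j) (hη1 : ∑ j, η j ^ 2 = 1)
    (ψ : OrthonormalBasis (Fin d) ℂ HA) (φ : OrthonormalBasis (Fin d) ℂ HK)
    (p : OrthonormalBasis (Fin (d ^ 2)) ℂ (HA ⊗[ℂ] HK))
    (hsol : MeanKing.SolvesMeanKing M (MeanKing.schmidtState η ψ φ) (MeanKing.basisPVM p)) :
    (∃ (L : Fin (d ^ 2) → (HK →ₗ[ℂ] HK)) (X : Fin n → Fin m → Finset (Fin (d ^ 2))),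
      MeanKing.IsKingError M (MeanKing.schmidtState η ψ φ) L X) ∧
    ∀ (L : Fin (d ^ 2) → (HK →ₗ[ℂ] HK)) (X : Fin n → Fin m → Finset (Fin (d ^ 2))),
      MeanKing.IsKingError M (MeanKing.schmidtState η ψ φ) L X →
      ∀ (HA' : Type*) [NormedAddCommGroup HA'] [InnerProductSpace ℂ HA']
        [FiniteDimensional ℂ HA'] (dA : ℕ) (_ : d ≤ dA) (ξ : OrthonormalBasis (Fin dA) ℂ HA'),
        MeanKing.IsQuantumCode (MeanKing.code η ξ φ) (dA * d) (dA / d) ∧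
        MeanKing.IsQECC (MeanKing.code η ξ φ) (fun k => MeanKing.ext HA' (L k)) ∧
        MeanKing.IsPVM (MeanKing.distinguishingMeasurement (MeanKing.code η ξ φ)
          (fun k => MeanKing.ext HA' (L k))) ∧
        ∀ χ ∈ MeanKing.code η ξ φ, ‖χ‖ = 1 →
          MeanKing.SolvesMeanKing M χ (MeanKing.distinguishingMeasurement (MeanKing.code η ξ φ)
            (fun k => MeanKing.ext HA' (L k))) := by
  have hd : 0 < d := by
    rcases Nat.eq_zero_or_pos d with rfl | hd
    · simp at hη1
    · exact hd
  refine ⟨MeanKing.exists_isKingError hd hη ψ φ p hsol, fun L X hL HA' _ _ _ dA _ ξ => ?_⟩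
  obtain ⟨β, hβ, h⟩ := MeanKing.isOrthogonalError_of_isKingError hd hη1 hL ξ
  obtain ⟨f, hf⟩ := hL.decomp
  -- The old guessing function, evaluated at an outcome that exists because `d ^ 2 > 0`, supplies
  -- the default guess.
  obtain ⟨-, -, guess, -⟩ := hsol
  exact ⟨MeanKing.isQuantumCode_code hη1 ξ φ, h.isQECC hβ (MeanKing.isError_ext hL.isError ξ),
    h.isPVM, fun χ hχ hχ1 => MeanKing.solvesMeanKing_distinguishingMeasurement h hL.disjoint hf
      (fun J => ⟨guess ⟨0, by positivity⟩ J⟩) hχ hχ1⟩
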